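/- Let $d\ge 2$ and let $A\subset\mathbb{R}^d$ be a nonempty compact set. Let $\mathrm{Unp}(A)$ be the set of points $y\in\mathbb{R}^d\setminus A$ that have a unique nearest point $\pi_A(y)$ in $A$, and let $$N(A):=\Big\{\Big(\pi_A(y),\tfrac{y-\pi_A(y)}{\operatorname{dist}(y,A)}\Big): y\in\mathrm{Unp}(A)\Big\}$$ be the generalized normal bundle of $A$. For $(x,u)\in N(A)$ the local reach is $\delta(A,x,u):=\sup\{t\ge 0:\pi_A(x+tu)=x\}\in[0,\infty]$, and $\delta(A,x,u):=0$ for $(x,u)\notin N(A)$. For $t>0$ let $$M_t(A):=\{x\in\partial A:\ \exists\,u\in\mathbb{S}^{d-1}\text{ with } t<\delta(A,x,u)\},$$ and let $\Theta_t(A)$ be the minimal number of open sets of diameter at most $t$ needed to cover $M_t(A)$. The upper and lower outer box dimensions of $A$ are $$\overline{\dim}^{\mathrm{out}}_B A:=\limsup_{t\to0^+}\frac{\log\Theta_t(A)}{-\log t},\qquad \underline{\dim}^{\mathrm{out}}_B A:=\liminf_{t\to0^+}\frac{\log\Theta_t(A)}{-\log t}.$$ Let $A_\varepsilon:=\{x\in\mathbb{R}^d:\operatorname{dist}(x,A)\le\varepsilon\}$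 and let $V$ be the Lebesgue measure on $\mathbb{R}^d$. The upper and lower outer Minkowski dimensions of $A$ are $$\overline{\dim}^{\mathrm{out}}_M A:=\inf\Big\{q\ge0:\limsup_{\varepsilon\to0^+}\varepsilon^{q-d}V(A_\varepsilon\setminus A)=0\Big\},\qquad \underline{\dim}^{\mathrm{out}}_M A:=\inf\Big\{q\ge0:\liminf_{\varepsilon\to0^+}\varepsilon^{q-d}V(A_\varepsilon\setminus A)=0\Big\}.$$ Then $$\overline{\dim}^{\mathrm{out}}_B A=\overline{\dim}^{\mathrm{out}}_M A\qquad\text{and}\qquad \underline{\dim}^{\mathrm{out}}_B A\le\underline{\dim}^{\mathrm{out}}_M A .$$ -/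

import Mathlib

open Filter Topology MeasureTheory
open scoped NNReal ENNReal

noncomputable section

namespace OuterBox

/-- The Euclidean space `ℝ^d`. -/
abbrev Eucl (d : ℕ) : Type := EuclideanSpace ℝ (Fin d)

variable {d : ℕ}

/-- `x` is a nearest point of `y` in `A`. -/
def IsNearest (A : Set (Eucl d)) (y x : Eucl d) : Prop :=
  x ∈ A ∧ ∀ a ∈ A, dist y x ≤ dist y a

/-- `Unp(A)`: the points outside `A` which have a unique nearest point in `A`. -/
def unp (A : Set (Eucl d)) : Set (Eucl d) :=
  {y | y ∉ A ∧ ∃! x, IsNearest A y x}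

/-- The graph of the metric projection `π_A : Unp(A) → A`: the relation `π_A(y) = x`. -/
def ProjEq (A : Set (Eucl d)) (y x : Eucl d) : Prop :=
  y ∈ unp A ∧ IsNearest A y x

/-- The generalized normal bundle
`N(A) = {(π_A(y), (y - π_A(y)) / dist(y, A)) : y ∈ Unp(A)}`. -/
def normalBundle (A : Set (Eucl d)) : Set (Eucl d × Eucl d) :=
  {p | ∃ y, ProjEq A y p.1 ∧ p.2 = (Metric.infDist y A)⁻¹ • (y - p.1)}

open scoped Classical in
/-- The local reach `δ(A, x, u) = sup {t ≥ 0 : π_A(x + t u) = x}` for `(x, u) ∈ N(A)`, with values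
in `[0, ∞]`; it is extended by `0` outside `N(A)`. -/
def reach (A : Set (Eucl d)) (x u : Eucl d) : ℝ≥0∞ :=
  if (x, u) ∈ normalBundle A then
    ⨆ (t : ℝ≥0) (_ : ProjEq A (x + (t : ℝ) • u) x), (t : ℝ≥0∞)
  else 0

/-- `M_t(A) = {x ∈ ∂A : ∃ u ∈ S^{d-1}, t < δ(A, x, u)}`. -/
def reachSet (t : ℝ) (A : Set (Eucl d)) : Set (Eucl d) :=
  {x | x ∈ frontier A ∧ ∃ u ∈ Metric.sphere (0 : Eucl d) 1, ENNReal.ofReal t < reach A x u}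

/-- `S` can be covered by `n` open sets of diameter at most `t`. -/
def HasOpenCover (t : ℝ) (S : Set (Eucl d)) (n : ℕ) : Prop :=
  ∃ U : Fin n → Set (Eucl d),
    (∀ i, IsOpen (U i) ∧ Metric.ediam (U i) ≤ ENNReal.ofReal t) ∧ S ⊆ ⋃ i, U i

/-- `Θ_t(A)`: the minimal number of open sets of diameter at most `t` needed to cover `M_t(A)`
(it would be `∞` if there were no finite cover). -/
def coverNum (t : ℝ) (A : Set (Eucl d)) : ℕ∞ :=
  ⨅ (n : ℕ) (_ : HasOpenCover t (reachSet t A) n), (n : ℕ∞)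

/-- The quotient `log Θ_t(A) / (- log t)`, with the conventions `log 0 = -∞`, `log ∞ = ∞`. -/
def boxQuotient (A : Set (Eucl d)) (t : ℝ) : EReal :=
  ENNReal.log (coverNum t A : ℝ≥0∞) / ((-Real.log t : ℝ) : EReal)

/-- The upper outer box dimension. -/
def upperOuterBoxDim (A : Set (Eucl d)) : EReal :=
  limsup (boxQuotient A) (𝓝[>] (0 : ℝ))

/-- The lower outer box dimension. -/
def lowerOuterBoxDim (A : Set (Eucl d)) : EReal :=
  liminf (boxQuotient A) (𝓝[>] (0 : ℝ))

/-- `ε^{q-d} V(A_ε \ A)`, where `A_ε` is the closed `ε`-parallel set of `A` and `V` is Lebesgue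
measure. -/
def outerMinkowskiQuotient (q : ℝ) (A : Set (Eucl d)) (ε : ℝ) : ℝ≥0∞ :=
  ENNReal.ofReal (ε ^ (q - d)) * volume (Metric.cthickening ε A \ A)

/-- The `q`-dimensional upper outer Minkowski content. -/
def upperOuterMinkowskiContent (q : ℝ) (A : Set (Eucl d)) : ℝ≥0∞ :=
  limsup (outerMinkowskiQuotient q A) (𝓝[>] (0 : ℝ))

/-- The `q`-dimensional lower outer Minkowski content. -/
def lowerOuterMinkowskiContent (q : ℝ) (A : Set (Eucl d)) : ℝ≥0∞ :=
  liminf (outerMinkowskiQuotient q A) (𝓝[>] (0 : ℝ))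

/-- The upper outer Minkowski dimension: the infimum of all real `q ≥ 0` for which the upper outer
Minkowski content vanishes. -/
def upperOuterMinkowskiDim (A : Set (Eucl d)) : EReal :=
  ⨅ (q : ℝ) (_ : 0 ≤ q ∧ upperOuterMinkowskiContent q A = 0), (q : EReal)

/-- The lower outer Minkowski dimension: the infimum of all real `q ≥ 0` for which the lower outer
Minkowski content vanishes. -/
def lowerOuterMinkowskiDim (A : Set (Eucl d)) : EReal :=
  ⨅ (q : ℝ) (_ : 0 ≤ q ∧ lowerOuterMinkowskiContent q A = 0), (q : EReal)

end OuterBox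

end

namespace OuterBox

open Metric Set Module

noncomputable section

variable {d : ℕ} {A : Set (Eucl d)}

/-! ### Nearest points and the reach -/

lemma mem_cthickening_iff_infDist_le (hne : A.Nonempty) {e : ℝ} (he : 0 ≤ e) {y : Eucl d} :
    y ∈ cthickening e A ↔ infDist y A ≤ e := by
  rw [mem_cthickening_iff, ENNReal.le_ofReal_iff_toReal_le (infEDist_ne_top hne) he]
  rfl

lemma IsNearest.infDist_eq {y x : Eucl d} (h : IsNearest A y x) : infDist y A = dist y x :=
  le_antisymm (infDist_le_dist_of_mem h.1) ((le_infDist ⟨x, h.1⟩).2 fun a ha ↦ h.2 a ha)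

lemma IsNearest.two_mul_inner_le {x u : Eucl d} {ρ : ℝ} (hu : ‖u‖ = 1) (hρ : 0 ≤ ρ)
    (h : IsNearest A (x + ρ • u) x) {a : Eucl d} (ha : a ∈ A) :
    2 * ρ * inner ℝ u (a - x) ≤ ‖a - x‖ ^ 2 := by
  have h1 := h.2 a ha
  have e1 : dist (x + ρ • u) x = ρ := by simp [norm_smul, hu, abs_of_nonneg hρ]
  have e2 : dist (x + ρ • u) a = ‖ρ • u - (a - x)‖ := by rw [dist_eq_norm]; congr 1; abel
  have h2 : ρ ^ 2 ≤ ‖ρ • u - (a - x)‖ ^ 2 := by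
    rw [e1, e2] at h1; gcongr
  rw [norm_sub_sq_real, norm_smul, hu, inner_smul_left, Real.norm_of_nonneg hρ] at h2
  simp only [conj_trivial] at h2
  linarith

/-- Moving from a point towards one of its nearest points makes this nearest point unique. -/
lemma IsNearest.projEq_of_lt {x u : Eucl d} {ρ s : ℝ} (hu : ‖u‖ = 1) (hs : 0 < s) (hsρ : s < ρ)
    (h : IsNearest A (x + ρ • u) x) : ProjEq A (x + s • u) x := by
  have hρ : 0 < ρ := hs.trans hsρ
  have key : ∀ a ∈ A, dist (x + s • u) a ≤ s → a = x := by
    intro a ha hle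
    have h1 := h.two_mul_inner_le hu hρ.le ha
    have e2 : dist (x + s • u) a = ‖s • u - (a - x)‖ := by rw [dist_eq_norm]; congr 1; abel
    have h2 : ‖s • u - (a - x)‖ ^ 2 ≤ s ^ 2 := by rw [← e2]; gcongr
    rw [norm_sub_sq_real, norm_smul, hu, inner_smul_left, Real.norm_of_nonneg hs.le] at h2
    simp only [conj_trivial] at h2
    have h3 : ‖a - x‖ ^ 2 ≤ 0 := by
      have : (ρ - s) * ‖a - x‖ ^ 2 ≤ 0 := by nlinarith
      nlinarith
    have h4 : ‖a - x‖ = 0 := by nlinarith [norm_nonneg (a - x)]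
    exact sub_eq_zero.1 (norm_eq_zero.1 h4)
  have e1 : dist (x + s • u) x = s := by simp [norm_smul, hu, abs_of_pos hs]
  have hn : IsNearest A (x + s • u) x := by
    refine ⟨h.1, fun a ha ↦ ?_⟩
    by_contra! hlt
    rw [key a ha (hlt.le.trans e1.le)] at hlt
    exact lt_irrefl _ hlt
  refine ⟨⟨fun hA ↦ ?_, x, hn, fun z hz ↦ key z hz.1 ((hz.2 x h.1).trans e1.le)⟩, hn⟩
  have := key _ hA (by simpa using hs.le)
  rw [this, dist_self] at e1
  exact hs.ne e1

lemma ProjEq.mem_normalBundle {x u : Eucl d} {s : ℝ} (hu : ‖u‖ = 1) (hs : 0 < s)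
    (h : ProjEq A (x + s • u) x) : (x, u) ∈ normalBundle A := by
  refine ⟨x + s • u, h, ?_⟩
  have e1 : dist (x + s • u) x = s := by simp [norm_smul, hu, abs_of_pos hs]
  rw [h.2.infDist_eq, e1]
  simp [smul_smul, hs.ne']

/-- A nearest point of `y` at distance greater than `t` belongs to `M_t(A)`. -/
lemma IsNearest.mem_reachSet {x y : Eucl d} {t : ℝ} (ht : 0 ≤ t) (h : IsNearest A y x)
    (hlt : t < dist y x) : x ∈ reachSet t A := by
  set ρ := dist y x with hρ
  have hρ0 : 0 < ρ := ht.trans_lt hlt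
  set u : Eucl d := ρ⁻¹ • (y - x) with hu'
  have hu : ‖u‖ = 1 := by
    rw [hu', norm_smul, ← dist_eq_norm, ← hρ, Real.norm_of_nonneg (by positivity)]
    exact inv_mul_cancel₀ hρ0.ne'
  have hy : y = x + ρ • u := by rw [hu', smul_smul, mul_inv_cancel₀ hρ0.ne']; simp
  rw [hy] at h
  refine ⟨⟨subset_closure h.1, fun hint ↦ ?_⟩, u, by simpa using hu, ?_⟩
  · obtain ⟨e, he, hball⟩ := Metric.isOpen_iff.1 isOpen_interior x hint
    have hs : 0 < min (e / 2) (ρ / 2) := by positivity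
    have hsρ : min (e / 2) (ρ / 2) < ρ := (min_le_right _ _).trans_lt (by linarith)
    refine (h.projEq_of_lt hu hs hsρ).1.1 (interior_subset (hball ?_))
    rw [mem_ball]
    simp only [dist_self_add_left, norm_smul, hu, Real.norm_of_nonneg hs.le, mul_one]
    exact (min_le_left _ _).trans_lt (by linarith)
  · have hs : 0 < (t + ρ) / 2 := by linarith
    have hp := h.projEq_of_lt hu hs (by linarith)
    rw [reach, if_pos (hp.mem_normalBundle hu hs)]
    have : ENNReal.ofReal t < ((Real.toNNReal ((t + ρ) / 2) : ℝ≥0) : ℝ≥0∞) :=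
      (ENNReal.ofReal_lt_ofReal_iff hs).2 (by linarith)
    refine this.trans_le (le_iSup₂_of_le (Real.toNNReal ((t + ρ) / 2)) ?_ le_rfl)
    rwa [Real.coe_toNNReal _ hs.le]

lemma reachSet_nonempty (hd : 2 ≤ d) (hA : IsCompact A) (hne : A.Nonempty) {t : ℝ} (ht : 0 ≤ t) :
    (reachSet t A).Nonempty := by
  have : Nonempty (Fin d) := ⟨⟨0, by omega⟩⟩
  obtain ⟨y, hy⟩ : ∃ y : Eucl d, y ∉ cthickening t A := by
    by_contra! h
    have hb : Bornology.IsBounded (univ : Set (Eucl d)) :=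
      hA.isBounded.cthickening.subset fun y _ ↦ h y
    exact NormedSpace.unbounded_univ ℝ (Eucl d) hb
  obtain ⟨x, hx, hxy⟩ := hA.exists_infDist_eq_dist hne y
  refine ⟨x, IsNearest.mem_reachSet (y := y) ht
    ⟨hx, fun a ha ↦ hxy ▸ infDist_le_dist_of_mem ha⟩ ?_⟩
  by_contra! hle
  exact hy (mem_cthickening_of_dist_le _ _ _ _ hx hle)

lemma exists_ball_disjoint {x : Eucl d} {t r : ℝ} (hrt : r ≤ t) (hx : x ∈ reachSet t A) :
    ∃ u : Eucl d, ‖u‖ = 1 ∧ Disjoint (ball (x + r • u) r) A := by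
  obtain ⟨-, u, hu, hlt⟩ := hx
  rw [mem_sphere_zero_iff_norm] at hu
  refine ⟨u, hu, ?_⟩
  rw [reach] at hlt
  split_ifs at hlt with hN
  · obtain ⟨s, hs⟩ := lt_iSup_iff.1 hlt
    obtain ⟨hp, hs⟩ := lt_iSup_iff.1 hs
    have hts : t ≤ s := by
      by_contra! h
      refine hs.not_ge ?_
      rw [← ENNReal.ofReal_coe_nnreal]
      exact ENNReal.ofReal_le_ofReal h.le
    rw [Set.disjoint_left]
    intro a ha haA
    have h1 := hp.2.2 a haA
    have e1 : dist (x + (s : ℝ) • u) x = s := by simp [norm_smul, hu]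
    have e2 : dist (x + (s : ℝ) • u) (x + r • u) = s - r := by
      rw [dist_add_left, dist_eq_norm, ← sub_smul, norm_smul, hu, mul_one,
        Real.norm_of_nonneg (by linarith)]
    have h3 := dist_triangle (x + (s : ℝ) • u) (x + r • u) a
    rw [mem_ball, dist_comm] at ha
    linarith
  · exact absurd hlt (by simp)

/-! ### Covering numbers and volumes -/

lemma reachSet_subset (hA : IsCompact A) (t : ℝ) : reachSet t A ⊆ A :=
  fun _ hx ↦ hA.isClosed.frontier_subset hx.1

lemma coverNum_le_encard {t : ℝ} {r : ℝ≥0} (hrt : 2 * (r : ℝ) < t) {N : Set (Eucl d)}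
    (hN : N.Finite) (hcov : IsCover r (reachSet t A) N) : coverNum t A ≤ N.encard := by
  have hcard : N.encard = (N.ncard : ℕ∞) := hN.cast_ncard_eq.symm
  rw [hcard]
  refine iInf₂_le N.ncard ?_
  have : Finite N := hN
  let e : Fin N.ncard ≃ N := (Finite.equivFinOfCardEq rfl).symm
  refine ⟨fun i ↦ ball (e i : Eucl d) (t / 2), fun i ↦ ⟨isOpen_ball, ?_⟩, fun x hx ↦ ?_⟩
  · refine ediam_le_of_forall_dist_le fun a ha b hb ↦ ?_
    have := dist_triangle_right a b (e i : Eucl d)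
    rw [mem_ball] at ha hb
    linarith
  · obtain ⟨y, hy, hxy⟩ := hcov hx
    have hxy' : dist x y ≤ r := by
      have : edist x y ≤ r := hxy
      rwa [edist_dist, ENNReal.ofReal_le_coe] at this
    obtain ⟨i, hi⟩ := e.surjective ⟨y, hy⟩
    refine mem_iUnion.2 ⟨i, ?_⟩
    rw [hi, mem_ball]
    linarith

lemma packingNumber_reachSet_ne_top (hA : IsCompact A) (t : ℝ) {r : ℝ≥0} (hr : r ≠ 0) :
    packingNumber r (reachSet t A) ≠ ⊤ := by
  obtain ⟨N, -, hN, hcov⟩ := exists_finite_isCover_of_isCompact (ε := r / 2) (by positivity) hA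
  have h1 := packingNumber_two_mul_le_externalCoveringNumber (r / 2) (reachSet t A)
  rw [mul_div_cancel₀ r two_ne_zero] at h1
  have h2 := (hcov.anti (reachSet_subset hA t)).externalCoveringNumber_le_encard
  exact ((h1.trans h2).trans_lt hN.encard_lt_top).ne

lemma volume_ball_eq (hd : 2 ≤ d) (x : Eucl d) {r : ℝ} (hr : 0 ≤ r) :
    volume (ball x r) = ENNReal.ofReal (r ^ d) * volume (ball (0 : Eucl d) 1) := by
  have : Nonempty (Fin d) := ⟨⟨0, by omega⟩⟩
  simpa using Measure.addHaar_ball volume x hr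

lemma volume_closedBall_eq (x : Eucl d) {r : ℝ} (hr : 0 ≤ r) :
    volume (closedBall x r) = ENNReal.ofReal (r ^ d) * volume (ball (0 : Eucl d) 1) := by
  simpa using Measure.addHaar_closedBall volume x hr

lemma coverNum_mul_volume_le (hA : IsCompact A) {t : ℝ} (ht : 0 < t) :
    (coverNum t A : ℝ≥0∞) * volume (ball (0 : Eucl d) (t / 16)) ≤
      volume (cthickening t A \ A) := by
  let r : ℝ≥0 := ⟨t / 4, by positivity⟩
  have hr' : (r : ℝ) = t / 4 := rfl
  have hr : r ≠ 0 := by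
    rw [← NNReal.coe_ne_zero, hr']; positivity
  have htop := packingNumber_reachSet_ne_top hA t hr
  set N := maximalSeparatedSet r (reachSet t A) with hNdef
  have hfin : N.Finite := by
    rw [← Set.encard_lt_top_iff, hNdef, encard_maximalSeparatedSet htop]
    exact htop.lt_top
  have hsub : N ⊆ reachSet t A := maximalSeparatedSet_subset
  have hsep : IsSeparated r N := isSeparated_maximalSeparatedSet
  have hle : coverNum t A ≤ N.encard :=
    coverNum_le_encard (by rw [hr']; linarith) hfin (isCover_maximalSeparatedSet htop)
  have hex : ∀ x : N, ∃ u : Eucl d,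
      ‖u‖ = 1 ∧ Disjoint (ball ((x : Eucl d) + (t / 16) • u) (t / 16)) A :=
    fun x ↦ exists_ball_disjoint (by linarith) (hsub x.2)
  choose u hu hdis using hex
  have hdist : ∀ x : N, ∀ z ∈ ball ((x : Eucl d) + (t / 16) • u x) (t / 16),
      dist z x < t / 8 := by
    intro x z hz
    have h1 := dist_triangle z ((x : Eucl d) + (t / 16) • u x) x
    have h2 : dist ((x : Eucl d) + (t / 16) • u x) x = t / 16 := by
      simp [norm_smul, hu, abs_of_pos ht]
    rw [mem_ball] at hz
    linarith
  have := hfin.to_subtype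
  calc (coverNum t A : ℝ≥0∞) * volume (ball (0 : Eucl d) (t / 16))
      ≤ (N.encard : ℝ≥0∞) * volume (ball (0 : Eucl d) (t / 16)) := by gcongr
    _ = ∑' x : N, volume (ball ((x : Eucl d) + (t / 16) • u x) (t / 16)) := by
        simp_rw [Measure.addHaar_ball_center]
        rw [ENNReal.tsum_const]
        rfl
    _ = volume (⋃ x : N, ball ((x : Eucl d) + (t / 16) • u x) (t / 16)) := by
        refine (measure_iUnion (fun x y hxy ↦ ?_) fun _ ↦ measurableSet_ball).symm
        refine Set.disjoint_left.2 fun z hx hy ↦ ?_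
        have h1 := hdist x z hx
        have h2 := hdist y z hy
        have h3 : (r : ℝ≥0∞) < edist (x : Eucl d) y := hsep x.2 y.2 (Subtype.coe_injective.ne hxy)
        rw [edist_dist, ← ENNReal.ofReal_coe_nnreal,
          ENNReal.ofReal_lt_ofReal_iff_of_nonneg r.coe_nonneg, hr'] at h3
        have h4 := dist_triangle_left (x : Eucl d) y z
        linarith
    _ ≤ volume (cthickening t A \ A) := by
        refine measure_mono (iUnion_subset fun x z hz ↦ ⟨?_, Set.disjoint_left.1 (hdis x) hz⟩)
        exact mem_cthickening_of_dist_le _ _ _ _ (reachSet_subset hA t (hsub x.2))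
          ((hdist x z hz).le.trans (by linarith))

lemma exists_hasOpenCover (hA : IsCompact A) {t : ℝ} (ht : 0 < t) :
    ∃ n : ℕ, HasOpenCover t (reachSet t A) n ∧ coverNum t A = n := by
  have hlt : coverNum t A < ⊤ := by
    let r : ℝ≥0 := ⟨t / 4, by positivity⟩
    have hr' : (r : ℝ) = t / 4 := rfl
    have hr : r ≠ 0 := by
      rw [← NNReal.coe_ne_zero, hr']; positivity
    obtain ⟨N, -, hN, hcov⟩ := exists_finite_isCover_of_isCompact hr hA
    exact (coverNum_le_encard (by rw [hr']; linarith) hN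
      (hcov.anti (reachSet_subset hA t))).trans_lt hN.encard_lt_top
  have hex : ∃ n : ℕ, HasOpenCover t (reachSet t A) n := by
    by_contra! h
    simp [coverNum, h] at hlt
  classical
  refine ⟨Nat.find hex, Nat.find_spec hex, le_antisymm (iInf₂_le _ (Nat.find_spec hex)) ?_⟩
  exact le_iInf₂ fun n hn ↦ by exact_mod_cast Nat.find_min' hex hn

lemma one_le_coverNum (hd : 2 ≤ d) (hA : IsCompact A) (hne : A.Nonempty) {t : ℝ} (ht : 0 < t) :
    1 ≤ coverNum t A := by
  obtain ⟨n, ⟨U, -, hU⟩, hn⟩ := exists_hasOpenCover hA ht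
  obtain ⟨x, hx⟩ := reachSet_nonempty hd hA hne ht.le
  obtain ⟨i, -⟩ := mem_iUnion.1 (hU hx)
  rw [hn]
  exact_mod_cast (Nat.zero_le _).trans_lt i.2

lemma volume_cthickening_diff_le (hA : IsCompact A) (hne : A.Nonempty) {r : ℝ} (hr : 0 < r) :
    volume (cthickening (2 * r) A \ cthickening r A) ≤
      coverNum r A * volume (closedBall (0 : Eucl d) (3 * r)) := by
  obtain ⟨n, ⟨U, hU, hcov⟩, hn⟩ := exists_hasOpenCover hA hr
  have hball : ∀ i, ∃ p, ∀ x ∈ U i, dist x p ≤ r := by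
    intro i
    rcases (U i).eq_empty_or_nonempty with h | ⟨p, hp⟩
    · exact ⟨0, by simp [h]⟩
    · refine ⟨p, fun x hx ↦ ?_⟩
      have := (edist_le_ediam_of_mem hx hp).trans (hU i).2
      rwa [edist_dist, ENNReal.ofReal_le_ofReal_iff hr.le] at this
  choose p hp using hball
  calc volume (cthickening (2 * r) A \ cthickening r A)
      ≤ volume (⋃ i, closedBall (p i) (3 * r)) := by
        refine measure_mono fun y ⟨hy, hy'⟩ ↦ ?_
        obtain ⟨x, hx, hxy⟩ := hA.exists_infDist_eq_dist hne y
        have h1 : dist y x ≤ 2 * r := by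
          rwa [mem_cthickening_iff_infDist_le hne (by positivity), hxy] at hy
        have h2 : r < dist y x := by
          by_contra! hle
          exact hy' (mem_cthickening_of_dist_le _ _ _ _ hx hle)
        have hmem : x ∈ reachSet r A :=
          IsNearest.mem_reachSet hr.le ⟨hx, fun a ha ↦ hxy ▸ infDist_le_dist_of_mem ha⟩ h2
        obtain ⟨i, hi⟩ := mem_iUnion.1 (hcov hmem)
        refine mem_iUnion.2 ⟨i, ?_⟩
        have := dist_triangle y x (p i)
        have := hp i x hi
        rw [mem_closedBall]
        linarith
    _ ≤ ∑ i, volume (closedBall (p i) (3 * r)) := measure_iUnion_fintype_le _ _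
    _ = coverNum r A * volume (closedBall (0 : Eucl d) (3 * r)) := by
        simp_rw [Measure.addHaar_closedBall_center]
        simp [hn]

/-! ### The box quotient -/

lemma boxQuotient_le_iff {t q : ℝ} (ht : 0 < t) (ht1 : t < 1) :
    boxQuotient A t ≤ q ↔ (coverNum t A : ℝ≥0∞) ≤ ENNReal.ofReal (t ^ (-q)) := by
  have hlog : 0 < -Real.log t := neg_pos.2 (Real.log_neg ht ht1)
  rw [boxQuotient, EReal.div_le_iff_le_mul (by exact_mod_cast hlog) (EReal.coe_ne_top _),
    ← ENNReal.log_le_log_iff, ENNReal.log_ofReal_of_pos (by positivity), Real.log_rpow ht,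
    ← EReal.coe_mul, neg_mul_comm, mul_comm (Real.log t)]

lemma ioo_mem_nhdsGT_zero {e : ℝ} (he : 0 < e) : ∀ᶠ t in 𝓝[>] (0 : ℝ), 0 < t ∧ t < e :=
  Ioo_mem_nhdsGT he

lemma upperOuterBoxDim_nonneg (hd : 2 ≤ d) (hA : IsCompact A) (hne : A.Nonempty) :
    0 ≤ upperOuterBoxDim A := by
  refine le_limsup_of_frequently_le (Eventually.frequently ?_)
  filter_upwards [ioo_mem_nhdsGT_zero one_pos] with t ⟨ht, ht1⟩
  refine EReal.div_nonneg ?_ ?_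
  · rw [← ENNReal.log_one, ENNReal.log_le_log_iff]
    exact_mod_cast one_le_coverNum hd hA hne ht
  · exact_mod_cast (neg_pos.2 (Real.log_neg ht ht1)).le

/-! ### The box dimensions are at most the Minkowski dimensions -/

lemma boxQuotient_le_of_outerMinkowskiQuotient_lt (hd : 2 ≤ d) (hA : IsCompact A) {q t : ℝ}
    (ht : 0 < t) (ht1 : t < 1)
    (h : outerMinkowskiQuotient q A t < volume (ball (0 : Eucl d) (1 / 16))) :
    boxQuotient A t ≤ q := by
  rw [boxQuotient_le_iff ht ht1]
  set c := volume (ball (0 : Eucl d) (1 / 16)) with hc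
  have hc0 : c ≠ 0 := (measure_ball_pos _ _ (by norm_num)).ne'
  have hct : c ≠ ⊤ := measure_ball_lt_top.ne
  have h1 := coverNum_mul_volume_le hA ht
  have h2 : volume (ball (0 : Eucl d) (t / 16)) = ENNReal.ofReal (t ^ d) * c := by
    rw [hc, volume_ball_eq hd _ (by positivity), volume_ball_eq hd 0 (r := 1 / 16) (by norm_num), ← mul_assoc,
      ← ENNReal.ofReal_mul (by positivity), ← mul_pow, ← div_eq_mul_one_div]
  rw [h2] at h1
  have h3 : ENNReal.ofReal (t ^ (q - d)) * ((coverNum t A : ℝ≥0∞) * (ENNReal.ofReal (t ^ d) * c))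
      ≤ c := (mul_le_mul_right h1 _).trans h.le
  have h4 : ENNReal.ofReal (t ^ (q - d)) * ((coverNum t A : ℝ≥0∞) * (ENNReal.ofReal (t ^ d) * c))
      = (ENNReal.ofReal (t ^ q) * coverNum t A) * c := by
    have : t ^ q = t ^ (q - d) * t ^ d := by
      rw [← Real.rpow_natCast t d, ← Real.rpow_add ht]; simp
    rw [this, ENNReal.ofReal_mul (by positivity)]
    ring
  rw [h4] at h3
  have h5 : ENNReal.ofReal (t ^ q) * coverNum t A ≤ 1 := by
    refine (ENNReal.mul_le_mul_iff_left hc0 hct).1 ?_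
    rwa [one_mul]
  rw [Real.rpow_neg ht.le, ENNReal.ofReal_inv_of_pos (by positivity)]
  rw [mul_comm] at h5
  exact ENNReal.le_inv_iff_mul_le.2 h5

lemma upperOuterBoxDim_le (hd : 2 ≤ d) (hA : IsCompact A) :
    upperOuterBoxDim A ≤ upperOuterMinkowskiDim A := by
  refine le_iInf₂ fun q hq ↦ ?_
  have hc : 0 < volume (ball (0 : Eucl d) (1 / 16)) := measure_ball_pos _ _ (by norm_num)
  refine limsup_le_of_le (by isBoundedDefault) ?_
  filter_upwards [ioo_mem_nhdsGT_zero one_pos,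
    eventually_lt_of_limsup_lt (hq.2.trans_lt hc)] with t ⟨ht, ht1⟩ h
  exact boxQuotient_le_of_outerMinkowskiQuotient_lt hd hA ht ht1 h

lemma lowerOuterBoxDim_le (hd : 2 ≤ d) (hA : IsCompact A) :
    lowerOuterBoxDim A ≤ lowerOuterMinkowskiDim A := by
  refine le_iInf₂ fun q hq ↦ ?_
  have hc : 0 < volume (ball (0 : Eucl d) (1 / 16)) := measure_ball_pos _ _ (by norm_num)
  refine liminf_le_of_frequently_le ?_ (by isBoundedDefault)
  refine ((frequently_lt_of_liminf_lt (by isBoundedDefault)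
    (hq.2.trans_lt hc)).and_eventually (ioo_mem_nhdsGT_zero one_pos)).mono ?_
  rintro t ⟨h, ht, ht1⟩
  exact boxQuotient_le_of_outerMinkowskiQuotient_lt hd hA ht ht1 h

/-! ### The upper Minkowski dimension is at most the upper box dimension -/

lemma cthickening_diff_subset_iUnion (hA : IsCompact A) (hne : A.Nonempty) {e : ℝ} (he : 0 < e) :
    cthickening e A \ A ⊆
      ⋃ k : ℕ, cthickening (2 * (e / 2 ^ (k + 1))) A \ cthickening (e / 2 ^ (k + 1)) A := by
  rintro y ⟨hy, hyA⟩
  have hpos : 0 < infDist y A := (hA.isClosed.notMem_iff_infDist_pos hne).1 hyA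
  rw [mem_cthickening_iff_infDist_le hne he.le] at hy
  obtain ⟨k, hk1, hk2⟩ := exists_nat_pow_near ((one_le_div hpos).2 hy) one_lt_two
  rw [le_div_iff₀ hpos] at hk1
  rw [div_lt_iff₀ hpos] at hk2
  refine mem_iUnion.2 ⟨k, ?_, ?_⟩
  · rw [mem_cthickening_iff_infDist_le hne (by positivity), pow_succ, ← mul_div_assoc,
      le_div_iff₀ (by positivity)]
    linarith
  · rw [mem_cthickening_iff_infDist_le hne (by positivity), not_le, div_lt_iff₀ (by positivity)]
    linarith

lemma volume_cthickening_diff_le_of_coverNum_le (hA : IsCompact A) (hne : A.Nonempty) {s e₀ : ℝ}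
    (hs : s < d) (h : ∀ t, 0 < t → t < e₀ → (coverNum t A : ℝ≥0∞) ≤ ENNReal.ofReal (t ^ (-s))) :
    ∃ C : ℝ≥0∞, C ≠ ⊤ ∧ ∀ e, 0 < e → e < e₀ →
      volume (cthickening e A \ A) ≤ C * ENNReal.ofReal (e ^ (d - s)) := by
  set v := volume (ball (0 : Eucl d) 1) with hv
  have hvt : v ≠ ⊤ := measure_ball_lt_top.ne
  set ρ : ℝ := 2⁻¹ ^ (d - s) with hρ
  have hρ0 : 0 < ρ := by positivity
  have hρ1 : ρ < 1 := Real.rpow_lt_one (by norm_num) (by norm_num) (sub_pos.2 hs)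
  refine ⟨ENNReal.ofReal (3 ^ d) * v * ∑' k : ℕ, ENNReal.ofReal ρ ^ (k + 1), ?_, fun e he he' ↦ ?_⟩
  · refine ENNReal.mul_ne_top (ENNReal.mul_ne_top ENNReal.ofReal_ne_top hvt) ?_
    rw [ENNReal.tsum_geometric_add_one]
    refine ENNReal.mul_ne_top ENNReal.ofReal_ne_top (ENNReal.inv_ne_top.2 ?_)
    exact (tsub_pos_of_lt (ENNReal.ofReal_lt_one.2 hρ1)).ne'
  have hterm : ∀ k : ℕ,
      volume (cthickening (2 * (e / 2 ^ (k + 1))) A \ cthickening (e / 2 ^ (k + 1)) A) ≤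
        ENNReal.ofReal (3 ^ d) * v * ENNReal.ofReal (e ^ (d - s)) * ENNReal.ofReal ρ ^ (k + 1) := by
    intro k
    set r := e / 2 ^ (k + 1) with hr
    have hr0 : 0 < r := by positivity
    have hre : r < e₀ := (div_le_self he.le (one_le_pow₀ one_le_two)).trans_lt he'
    have hpow : r ^ (-s) * (3 * r) ^ d = 3 ^ d * (e ^ (d - s) * ρ ^ (k + 1)) := by
      have h1 : r ^ (d - s) = e ^ (d - s) * ρ ^ (k + 1) := by
        rw [hr, div_eq_mul_inv, ← inv_pow, Real.mul_rpow he.le (by positivity), hρ,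
          ← Real.rpow_natCast, ← Real.rpow_natCast, ← Real.rpow_mul (by norm_num),
          ← Real.rpow_mul (by norm_num), mul_comm (((k + 1 : ℕ) : ℝ))]
      rw [← h1, mul_pow, ← Real.rpow_natCast r d, mul_left_comm, ← Real.rpow_add hr0,
        neg_add_eq_sub]
    calc volume (cthickening (2 * r) A \ cthickening r A)
        ≤ coverNum r A * volume (closedBall (0 : Eucl d) (3 * r)) :=
          volume_cthickening_diff_le hA hne hr0
      _ ≤ ENNReal.ofReal (r ^ (-s)) * (ENNReal.ofReal ((3 * r) ^ d) * v) := by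
          rw [volume_closedBall_eq _ (by positivity)]
          gcongr
          exact h r hr0 hre
      _ = _ := by
          rw [← mul_assoc, ← ENNReal.ofReal_mul (by positivity), hpow,
            ENNReal.ofReal_mul (by positivity), ENNReal.ofReal_mul (by positivity),
            ENNReal.ofReal_pow hρ0.le]
          ring
  calc volume (cthickening e A \ A)
      ≤ volume (⋃ k : ℕ, cthickening (2 * (e / 2 ^ (k + 1))) A \
          cthickening (e / 2 ^ (k + 1)) A) :=
        measure_mono (cthickening_diff_subset_iUnion hA hne he)
    _ ≤ ∑' k : ℕ, volume (cthickening (2 * (e / 2 ^ (k + 1))) A \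
          cthickening (e / 2 ^ (k + 1)) A) := measure_iUnion_le _
    _ ≤ ∑' k : ℕ, ENNReal.ofReal (3 ^ d) * v * ENNReal.ofReal (e ^ (d - s)) *
          ENNReal.ofReal ρ ^ (k + 1) := ENNReal.tsum_le_tsum hterm
    _ = _ := by rw [ENNReal.tsum_mul_left]; ring

lemma upperOuterMinkowskiDim_le_dim (hA : IsCompact A) :
    upperOuterMinkowskiDim A ≤ ((d : ℝ) : EReal) := by
  refine iInf₂_le (d : ℝ) ⟨d.cast_nonneg, Tendsto.limsup_eq ?_⟩
  have h1 : Tendsto (fun e ↦ volume (cthickening e A) - volume A) (𝓝[>] 0) (𝓝 0) := by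
    have := ENNReal.Tendsto.sub (tendsto_measure_cthickening_of_isCompact (μ := volume) hA)
      (tendsto_const_nhds (x := volume A)) (Or.inl hA.measure_lt_top.ne)
    rw [tsub_self] at this
    exact this.mono_left nhdsWithin_le_nhds
  refine h1.congr fun e ↦ ?_
  rw [outerMinkowskiQuotient, measure_sdiff (self_subset_cthickening A)
    hA.measurableSet.nullMeasurableSet hA.measure_lt_top.ne]
  simp

lemma upperOuterMinkowskiDim_le_of_lt (hA : IsCompact A) (hne : A.Nonempty) {s q : ℝ}
    (hs : upperOuterBoxDim A < s) (hsd : s < d) (hq : 0 ≤ q) (hsq : s < q) :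
    upperOuterMinkowskiDim A ≤ q := by
  refine iInf₂_le q ⟨hq, Tendsto.limsup_eq ?_⟩
  have hev : ∀ᶠ t in 𝓝[>] (0 : ℝ), (coverNum t A : ℝ≥0∞) ≤ ENNReal.ofReal (t ^ (-s)) := by
    filter_upwards [ioo_mem_nhdsGT_zero one_pos, eventually_lt_of_limsup_lt hs]
      with t ⟨ht, ht1⟩ h
    exact (boxQuotient_le_iff ht ht1).1 h.le
  obtain ⟨e₀, he₀, hcov⟩ := mem_nhdsGT_iff_exists_Ioo_subset.1 hev
  obtain ⟨C, hC, hvol⟩ := volume_cthickening_diff_le_of_coverNum_le hA hne hsd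
    fun t ht ht' ↦ hcov ⟨ht, ht'⟩
  have hlim : Tendsto (fun e : ℝ ↦ C * ENNReal.ofReal (e ^ (q - s))) (𝓝[>] 0) (𝓝 0) := by
    have h1 : Tendsto (fun e : ℝ ↦ e ^ (q - s)) (𝓝[>] 0) (𝓝 0) := by
      have := (Real.continuousAt_rpow_const 0 (q - s) (Or.inr (sub_pos.2 hsq).le)).tendsto
      rw [Real.zero_rpow (sub_pos.2 hsq).ne'] at this
      exact this.mono_left nhdsWithin_le_nhds
    simpa using ENNReal.Tendsto.const_mul (ENNReal.tendsto_ofReal h1) (Or.inr hC)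
  refine tendsto_of_tendsto_of_tendsto_of_le_of_le' tendsto_const_nhds hlim
    (Eventually.of_forall fun _ ↦ zero_le) ?_
  filter_upwards [ioo_mem_nhdsGT_zero he₀] with e ⟨he, he'⟩
  calc outerMinkowskiQuotient q A e
      ≤ ENNReal.ofReal (e ^ (q - d)) * (C * ENNReal.ofReal (e ^ (d - s))) := by
        rw [outerMinkowskiQuotient]
        gcongr
        exact hvol e he he'
    _ = C * ENNReal.ofReal (e ^ (q - s)) := by
        rw [mul_left_comm, ← ENNReal.ofReal_mul (by positivity), ← Real.rpow_add he,
          sub_add_sub_cancel]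

lemma upperOuterMinkowskiDim_le (hd : 2 ≤ d) (hA : IsCompact A) (hne : A.Nonempty) :
    upperOuterMinkowskiDim A ≤ upperOuterBoxDim A := by
  rcases le_or_gt ((d : ℝ) : EReal) (upperOuterBoxDim A) with h | h
  · exact (upperOuterMinkowskiDim_le_dim hA).trans h
  refine le_of_forall_gt_imp_ge_of_dense fun c hc ↦ ?_
  obtain ⟨q, hq, hqc⟩ := EReal.lt_iff_exists_real_btwn.1 (lt_min hc h)
  obtain ⟨s, hs, hsq⟩ := EReal.lt_iff_exists_real_btwn.1 hq
  have hq0 : 0 ≤ q := by exact_mod_cast (upperOuterBoxDim_nonneg hd hA hne).trans hq.le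
  have hsd : s < d := by exact_mod_cast hsq.trans (hqc.trans_le (min_le_right _ _))
  exact (upperOuterMinkowskiDim_le_of_lt hA hne hs hsd hq0 (by exact_mod_cast hsq)).trans
    (hqc.trans_le (min_le_left _ _)).le

end

end OuterBox

theorem proposition4p4 (d : ℕ) (hd : 2 ≤ d) (A : Set (EuclideanSpace ℝ (Fin d)))
    (hA : IsCompact A) (hne : A.Nonempty) :
    OuterBox.upperOuterBoxDim A = OuterBox.upperOuterMinkowskiDim A ∧
      OuterBox.lowerOuterBoxDim A ≤ OuterBox.lowerOuterMinkowskiDim A :=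
  ⟨le_antisymm (OuterBox.upperOuterBoxDim_le hd hA) (OuterBox.upperOuterMinkowskiDim_le hd hA hne),
    OuterBox.lowerOuterBoxDim_le hd hA⟩
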